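/- Let $S$ be a free (discrete) group on a finite basis $A$ and let $n\ge 1$. Let $S^{(1)}=S$, $S^{(i)}=[S,S^{(i-1)}]$ for $i\ge 2$, be the lower central filtration of $S$, and let $\mathbb{U}_n(\mathbb{Z})$ be the group of all upper-triangular unipotent $n\times n$ matrices over $\mathbb{Z}$. Let $\mathbb{Z}\langle\langle X_A\rangle\rangle$ be the ring of formal power series $\sum_I c_I X_I$ with integer coefficients in non-commuting variables $X_a$, $a\in A$, where $I=(a_1,\dots,a_t)$ runs over all finite sequences of elements of $A$, $X_I=X_{a_1}\cdots X_{a_t}$ and $|I|=t$, and let $\Lambda\colon S\to\mathbb{Z}\langle\langle X_A\rangle\rangle^\times$ be the Magnus homomorphism, defined by $\Lambda(a)=1+X_a$ for $a\in A$. Then \[ S^{(n)}=\bigcap\{\operatorname{Ker}(\varphi)\mid \varphi\colon S\to\mathbb{U}_n(\mathbb{Z})\text{ a group homomorphism}\}, \] and this subgroup is also the Magnus dimension subgroup, i.e. \[ S^{(n)}=\Bigl\{\sigma\in S\;\Big|\;\Lambda(\sigma)=1+\sum_{|I|\ge n}c_IX_I\text{ for some }c_I\in\mathbb{Z}\Bigr\}.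 \] -/

import Mathlib

noncomputable section

/-- The Magnus algebra `R⟨⟨X_A⟩⟩` of formal power series `∑ c_I X_I` in non-commuting variables
`X_a`, `a ∈ A`: a series is identified with its family of coefficients `I ↦ c_I`, where `I` runs
over all finite sequences of elements of `A`. -/
def MagnusAlgebra (R A : Type*) : Type _ := List A → R

namespace MagnusAlgebra

variable {R A : Type*} [CommRing R]

instance : AddCommGroup (MagnusAlgebra R A) := inferInstanceAs (AddCommGroup (List A → R))

/-- The coefficient `c_I` of `X_I`. -/
def coeff {R A : Type*} (I : List A) (f : MagnusAlgebra R A) : R := f I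

@[ext]
theorem ext {R A : Type*} {f g : MagnusAlgebra R A} (h : ∀ I, coeff I f = coeff I g) : f = g := funext h

/-- The constant series `1`. -/
instance : One (MagnusAlgebra R A) := ⟨fun I => if I.isEmpty then 1 else 0⟩

/-- Multiplication of power series: the coefficient at `I` of a product is the sum over all
factorizations `I = I₁ I₂` of the products of coefficients at `I₁` and `I₂`. -/
instance : Mul (MagnusAlgebra R A) :=
  ⟨fun f g I => ∑ k ∈ Finset.range (I.length + 1), f (I.take k) * g (I.drop k)⟩

/-- The series `∑ c_{aI} X_I` obtained from `∑ c_I X_I`; only used in proofs. -/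
def tail {R A : Type*} (a : A) (f : MagnusAlgebra R A) : MagnusAlgebra R A := fun I => f (a :: I)

@[simp] theorem coeff_zero (I : List A) : coeff I (0 : MagnusAlgebra R A) = 0 := rfl
@[simp] theorem coeff_add (I : List A) (f g : MagnusAlgebra R A) :
    coeff I (f + g) = coeff I f + coeff I g := rfl
@[simp] theorem coeff_neg (I : List A) (f : MagnusAlgebra R A) :
    coeff I (-f) = -coeff I f := rfl
@[simp] theorem coeff_nil_one : coeff [] (1 : MagnusAlgebra R A) = 1 := rfl
@[simp] theorem coeff_cons_one (a : A) (I : List A) :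
    coeff (a :: I) (1 : MagnusAlgebra R A) = 0 := rfl
@[simp] theorem coeff_tail {R A : Type*} (a : A) (I : List A) (f : MagnusAlgebra R A) :
    coeff I (tail a f) = coeff (a :: I) f := rfl

theorem coeff_mul (I : List A) (f g : MagnusAlgebra R A) :
    coeff I (f * g) =
      ∑ k ∈ Finset.range (I.length + 1), coeff (I.take k) f * coeff (I.drop k) g := rfl

@[simp] theorem coeff_nil_mul (f g : MagnusAlgebra R A) :
    coeff [] (f * g) = coeff [] f * coeff [] g := by
  simp [coeff_mul]

@[simp] theorem coeff_cons_mul (a : A) (I : List A) (f g : MagnusAlgebra R A) :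
    coeff (a :: I) (f * g) = coeff [] f * coeff (a :: I) g + coeff I (tail a f * g) := by
  rw [coeff_mul, Finset.sum_range_succ', add_comm, coeff_mul]
  simp

theorem coeff_add_mul (I : List A) (f g h : MagnusAlgebra R A) :
    coeff I ((f + g) * h) = coeff I (f * h) + coeff I (g * h) := by
  simp [coeff_mul, add_mul, Finset.sum_add_distrib]

theorem coeff_mul_add (I : List A) (f g h : MagnusAlgebra R A) :
    coeff I (f * (g + h)) = coeff I (f * g) + coeff I (f * h) := by
  simp [coeff_mul, mul_add, Finset.sum_add_distrib]

theorem coeff_mul_assoc (I : List A) (f g h : MagnusAlgebra R A) :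
    coeff I (f * g * h) = coeff I (f * (g * h)) := by
  induction I generalizing f g h with
  | nil => simp [mul_assoc]
  | cons a I ih =>
    have key : coeff I (tail a (f * g) * h)
        = coeff [] f * coeff I (tail a g * h) + coeff I (tail a f * g * h) := by
      simp only [coeff_mul I, coeff_tail, coeff_cons_mul, add_mul, Finset.sum_add_distrib,
        Finset.mul_sum, mul_assoc]
    rw [coeff_cons_mul, key, coeff_cons_mul, coeff_cons_mul, ih]
    simp only [coeff_nil_mul]
    ring

theorem coeff_zero_mul (I : List A) (f : MagnusAlgebra R A) : coeff I (0 * f) = 0 := by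
  simp [coeff_mul]

theorem coeff_mul_zero (I : List A) (f : MagnusAlgebra R A) : coeff I (f * 0) = 0 := by
  simp [coeff_mul]

theorem coeff_one_mul (I : List A) (f : MagnusAlgebra R A) : coeff I (1 * f) = coeff I f := by
  cases I with
  | nil => simp
  | cons a I =>
    have h : tail a (1 : MagnusAlgebra R A) = 0 := rfl
    simp [h, coeff_zero_mul]

theorem coeff_mul_one (I : List A) (f : MagnusAlgebra R A) : coeff I (f * 1) = coeff I f := by
  induction I generalizing f with
  | nil => simp
  | cons a I ih => simp [ih]

instance : Ring (MagnusAlgebra R A) where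
  __ := (inferInstance : AddCommGroup (MagnusAlgebra R A))
  left_distrib f g h := ext fun I => coeff_mul_add I f g h
  right_distrib f g h := ext fun I => coeff_add_mul I f g h
  zero_mul f := ext fun I => coeff_zero_mul I f
  mul_zero f := ext fun I => coeff_mul_zero I f
  mul_assoc f g h := ext fun I => coeff_mul_assoc I f g h
  one_mul f := ext fun I => coeff_one_mul I f
  mul_one f := ext fun I => coeff_mul_one I f

open Classical in
/-- The variable `X_a`. -/
def X (a : A) : MagnusAlgebra R A := fun I => if I = [a] then 1 else 0

open Classical in
/-- The series `∑ₖ (-1)ᵏ X_aᵏ`, the inverse of `1 + X_a`. -/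
def invOneAddX (a : A) : MagnusAlgebra R A :=
  fun I => if ∀ b ∈ I, b = a then (-1) ^ I.length else 0

@[simp] theorem coeff_nil_X (a : A) : coeff [] (X a : MagnusAlgebra R A) = 0 := by
  simp [coeff, X]

theorem tail_X_self (a : A) : tail a (X a : MagnusAlgebra R A) = 1 := by
  ext I
  cases I with
  | nil => rw [coeff_tail, coeff_nil_one]; simp [coeff, X]
  | cons b I => rw [coeff_tail, coeff_cons_one]; simp [coeff, X]

theorem tail_X_ne {a b : A} (h : b ≠ a) : tail b (X a : MagnusAlgebra R A) = 0 := by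
  ext I
  rw [coeff_tail, coeff_zero]
  simp [coeff, X, h]

@[simp] theorem coeff_nil_invOneAddX (a : A) :
    coeff [] (invOneAddX a : MagnusAlgebra R A) = 1 := by
  simp [coeff, invOneAddX]

theorem tail_invOneAddX_self (a : A) :
    tail a (invOneAddX a : MagnusAlgebra R A) = -invOneAddX a := by
  ext I
  rw [coeff_neg]
  by_cases h : ∀ b ∈ I, b = a
  · have h' : ∀ b ∈ a :: I, b = a := by simpa using h
    simp only [coeff, tail, invOneAddX, if_pos h, if_pos h', List.length_cons, pow_succ]
    ring
  · have h' : ¬ ∀ b ∈ a :: I, b = a := by simpa using h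
    simp only [coeff, tail, invOneAddX, if_neg h, if_neg h', neg_zero]

theorem tail_invOneAddX_ne {a b : A} (h : b ≠ a) :
    tail b (invOneAddX a : MagnusAlgebra R A) = 0 := by
  ext I
  rw [coeff_tail, coeff_zero]
  simp [coeff, invOneAddX, h]

theorem one_add_X_mul_inv (a : A) :
    (1 + X a) * invOneAddX a = (1 : MagnusAlgebra R A) := by
  ext I
  rw [add_mul, one_mul, coeff_add]
  cases I with
  | nil => simp
  | cons b I =>
    rw [coeff_cons_mul, ← coeff_tail b I (invOneAddX a)]
    by_cases h : b = a
    · subst h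
      simp [tail_X_self, tail_invOneAddX_self]
    · simp [tail_X_ne h, tail_invOneAddX_ne h]

theorem inv_mul_one_add_X (a : A) :
    invOneAddX a * (1 + X a) = (1 : MagnusAlgebra R A) := by
  ext I
  induction I with
  | nil => simp
  | cons b I ih =>
    rw [coeff_cons_mul, coeff_add, ← coeff_tail b I (X a)]
    by_cases h : b = a
    · subst h
      rw [tail_invOneAddX_self, tail_X_self, neg_mul, coeff_neg, ih]
      simp
    · simp [tail_X_ne h, tail_invOneAddX_ne h]

/-- `1 + X_a` as an element of the multiplicative group of the Magnus algebra. -/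
def oneAddX (a : A) : (MagnusAlgebra R A)ˣ where
  val := 1 + X a
  inv := invOneAddX a
  val_inv := one_add_X_mul_inv a
  inv_val := inv_mul_one_add_X a

/-- The set of all power series of the form `1 + ∑_{|I| ≥ n} c_I X_I` (for `n ≥ 1`). -/
def V (R A : Type*) [CommRing R] (n : ℕ) : Set (MagnusAlgebra R A) :=
  {f | coeff [] f = 1 ∧ ∀ I : List A, 1 ≤ I.length → I.length < n → coeff I f = 0}

end MagnusAlgebra

/-- The Magnus homomorphism `Λ : S → R⟨⟨X_A⟩⟩ˣ`, `a ↦ 1 + X_a`, of a free group `S` with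
basis `A`. -/
def magnusHom (R : Type*) [CommRing R] {A S : Type*} [Group S] (b : FreeGroupBasis A S) :
    S →* (MagnusAlgebra R A)ˣ :=
  b.lift MagnusAlgebra.oneAddX

theorem diag_mul_of_upperTriangular {n : ℕ} {R : Type*} [CommRing R]
    {M N : Matrix (Fin n) (Fin n) R} (hM : M.BlockTriangular id) (hN : N.BlockTriangular id)
    (i : Fin n) : (M * N) i i = M i i * N i i := by
  rw [Matrix.mul_apply]
  refine Finset.sum_eq_single i (fun k _ hk => ?_) (by simp)
  rcases lt_or_gt_of_ne hk with h | h
  · rw [hM h, zero_mul]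
  · rw [hN h, mul_zero]

/-- The group `U_n(R)` of upper-triangular unipotent `n × n` matrices over `R`. -/
def unitriangularGroup (n : ℕ) (R : Type*) [CommRing R] : Subgroup (GL (Fin n) R) where
  carrier := {g | (∀ i j : Fin n, j < i → g i j = 0) ∧ ∀ i : Fin n, g i i = 1}
  one_mem' := ⟨fun i j h => by simp [h.ne'], fun i => by simp⟩
  mul_mem' := by
    rintro g h ⟨hg, hg'⟩ ⟨hh, hh'⟩
    have tg : (g : Matrix (Fin n) (Fin n) R).BlockTriangular id := fun i j => hg i j
    have th : (h : Matrix (Fin n) (Fin n) R).BlockTriangular id := fun i j => hh i j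
    refine ⟨fun i j hij => (tg.mul th) hij, fun i => ?_⟩
    rw [Units.val_mul, diag_mul_of_upperTriangular tg th, hg', hh', one_mul]
  inv_mem' := by
    rintro g ⟨hg, hg'⟩
    have tg : (g : Matrix (Fin n) (Fin n) R).BlockTriangular id := fun i j => hg i j
    have ti : ((g⁻¹ : GL (Fin n) R) : Matrix (Fin n) (Fin n) R).BlockTriangular id := by
      rw [Matrix.coe_units_inv]
      have : Invertible (g : Matrix (Fin n) (Fin n) R) := g.invertible
      exact Matrix.blockTriangular_inv_of_blockTriangular tg
    refine ⟨fun i j hij => ti hij, fun i => ?_⟩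
    have h := diag_mul_of_upperTriangular tg ti i
    rw [← Units.val_mul, mul_inv_cancel, hg', one_mul] at h
    simpa using h.symm

/-- The kernel intersection of groups `H` and `G`: the intersection of the kernels of all
homomorphisms `H → G`. -/
def kerInt (H G : Type*) [Group H] [Group G] : Subgroup H := ⨅ φ : H →* G, φ.ker

end

/-! The three subgroups are compared cyclically: `S^(n)` lies in the kernel intersection, which lies
in the Magnus dimension subgroup, which lies in `S^(n)`.

The first inclusion (`lcf_le_kerInt_unitriangularGroup`) holds because commutators add up distances
from the diagonal. For the second (`kerInt_unitriangularGroup_le_magnusSubgroup`), each Magnus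
coefficient at a nonempty word of length less than `n` is an entry of a unipotent representation,
built from the coefficients at the subwords of that word.

The third, `magnusSubgroup_le_lcf`, is the deep one and goes by induction on the weight. Modulo
weight `m + 1`, the group `S^(m)` is generated by the commutators of Hall trees of weight `m`, whose
words are Lyndon (`lcf_eq_hallSpan`, via the rewriting in `commutatorElement_hall_mem`). The degree
`m` coefficients of `Λ` are additive on `S^(m)`, and the commutator of a Hall tree has coefficient
`1` at its own word and `0` at smaller words of the same length (`coeff_magnusHom_commutator_hall`).
As a Hall tree is determined by its word, this system is triangular: if the degree `m` part of
`Λ(σ)` vanishes, all exponents vanish one after another, so `σ` has weight `m + 1`. -/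

open scoped commutatorElement

noncomputable section

/-! ### Lower central filtration and commutator calculus modulo higher weight -/

namespace Subgroup

variable {G : Type*} [Group G]

/-- The three subgroups lemma modulo a normal subgroup. -/
theorem commutator_commutator_le_of_rotate {H₁ H₂ H₃ N : Subgroup G} [hN : N.Normal]
    (h1 : ⁅⁅H₂, H₃⁆, H₁⁆ ≤ N) (h2 : ⁅⁅H₃, H₁⁆, H₂⁆ ≤ N) : ⁅⁅H₁, H₂⁆, H₃⁆ ≤ N := by
  have key (H : Subgroup G) : H ≤ N ↔ H.map (QuotientGroup.mk' N) = ⊥ := by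
    rw [Subgroup.map_eq_bot_iff, QuotientGroup.ker_mk']
  simp only [key, Subgroup.map_commutator] at *
  exact Subgroup.commutator_commutator_eq_bot_of_rotate h1 h2

variable (G) in
/-- The lower central filtration indexed by weight: `lcf G 1 = G` and
`lcf G (n + 1) = [lcf G n, G]` for `n ≥ 1`. -/
def lcf (n : ℕ) : Subgroup G := (⊤ : Subgroup G).lowerCentralSeries (n - 1)

instance lcf_normal (n : ℕ) : (lcf G n).Normal := by
  unfold lcf; infer_instance

theorem lcf_one : lcf G 1 = ⊤ := rfl

theorem lcf_add_two (n : ℕ) : lcf G (n + 2) = ⁅lcf G (n + 1), ⊤⁆ := rfl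

theorem lcf_antitone : Antitone (lcf G) := fun _ _ h =>
  lowerCentralSeries_antitone _ (Nat.sub_le_sub_right h 1)

theorem commutator_lcf_succ_le (i j : ℕ) :
    ⁅lcf G (i + 1), lcf G (j + 1)⁆ ≤ lcf G (i + j + 2) := by
  induction j generalizing i with
  | zero => exact le_rfl
  | succ j ih =>
    rw [lcf_add_two j, commutator_comm]
    refine commutator_commutator_le_of_rotate ?_ ?_
    · rw [commutator_comm ⊤, ← lcf_add_two]
      refine (ih (i + 1)).trans (lcf_antitone (by omega))
    · refine (commutator_mono (ih i) le_rfl).trans ?_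
      rw [show i + j + 2 = (i + j + 1) + 1 by omega, ← lcf_add_two]
      exact lcf_antitone (by omega)

theorem commutator_lcf_le (i j : ℕ) : ⁅lcf G i, lcf G j⁆ ≤ lcf G (i + j) := by
  rcases i with _ | i
  · exact (commutator_le_right _ _).trans (lcf_antitone (by omega))
  rcases j with _ | j
  · exact (commutator_le_left _ _).trans (lcf_antitone (by omega))
  exact (commutator_lcf_succ_le i j).trans (lcf_antitone (by omega))

theorem commutatorElement_mem_lcf {i j : ℕ} {x y : G} (hx : x ∈ lcf G i) (hy : y ∈ lcf G j) :
    ⁅x, y⁆ ∈ lcf G (i + j) :=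
  commutator_lcf_le i j (commutator_mem_commutator hx hy)

/-- An element of weight `n` is central modulo weight `n + 1`. This replaces normality of `K` in the
arguments below. -/
theorem conj_mem_of_lcf_succ_le {K : Subgroup G} {n : ℕ} (hK : lcf G (n + 1) ≤ K) {z : G}
    (hz : z ∈ lcf G n) (hzK : z ∈ K) (g : G) : g * z * g⁻¹ ∈ K := by
  have h : ⁅g, z⁆ ∈ K := hK <| by
    rw [add_comm]
    exact commutatorElement_mem_lcf (i := 1) (by rw [lcf_one]; trivial) hz
  have : g * z * g⁻¹ = ⁅g, z⁆ * z := by simp [commutatorElement_def]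
  rw [this]
  exact K.mul_mem h hzK

theorem normal_of_lcf_le {K : Subgroup G} {n : ℕ} (hK : lcf G (n + 1) ≤ K)
    (hK' : K ≤ lcf G n) : K.Normal :=
  ⟨fun _ hz g => conj_mem_of_lcf_succ_le hK (hK' hz) hz g⟩

/-- For `y` of weight `j` and a subgroup `K` containing all elements of weight `i + j + 1`, the
elements `x` of weight `i` with `⁅x, y⁆ ∈ K` form a subgroup. -/
def commutatorLeft (K : Subgroup G) {i j : ℕ} (hK : lcf G (i + j + 1) ≤ K) {y : G}
    (hy : y ∈ lcf G j) : Subgroup G where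
  carrier := {x | x ∈ lcf G i ∧ ⁅x, y⁆ ∈ K}
  one_mem' := ⟨one_mem _, by simp⟩
  mul_mem' := by
    rintro a b ⟨ha, ha'⟩ ⟨hb, hb'⟩
    refine ⟨mul_mem ha hb, ?_⟩
    rw [commutatorElement_mul_left_eq_conj_mul]
    exact K.mul_mem
      (conj_mem_of_lcf_succ_le hK (commutatorElement_mem_lcf hb hy) hb' a) ha'
  inv_mem' := by
    rintro a ⟨ha, ha'⟩
    refine ⟨inv_mem ha, ?_⟩
    rw [commutatorElement_inv_left, ← commutatorElement_inv a y]
    simpa using conj_mem_of_lcf_succ_le hK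
      (inv_mem (commutatorElement_mem_lcf ha hy)) (K.inv_mem ha') a⁻¹

theorem mem_commutatorLeft {K : Subgroup G} {i j : ℕ} (hK : lcf G (i + j + 1) ≤ K) {x y : G}
    (hy : y ∈ lcf G j) : x ∈ commutatorLeft K hK hy ↔ x ∈ lcf G i ∧ ⁅x, y⁆ ∈ K := Iff.rfl

theorem lcf_succ_le_commutatorLeft {K : Subgroup G} {i j : ℕ} (hK : lcf G (i + j + 1) ≤ K)
    {y : G} (hy : y ∈ lcf G j) : lcf G (i + 1) ≤ commutatorLeft K hK hy := fun x hx =>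
  ⟨lcf_antitone (Nat.le_succ i) hx, hK <| by
    rw [show i + j + 1 = i + 1 + j by omega]
    exact commutatorElement_mem_lcf hx hy⟩

/-- Modulo weight `i + j + 1` the commutator is linear in its left entry, so generators suffice. -/
theorem commutatorElement_mem_of_mem_closure_sup {K : Subgroup G} {i j : ℕ}
    (hK : lcf G (i + j + 1) ≤ K) {s : Set G} {y : G} (hy : y ∈ lcf G j)
    (hs : ∀ x ∈ s, x ∈ lcf G i ∧ ⁅x, y⁆ ∈ K) {x : G} (hx : x ∈ closure s ⊔ lcf G (i + 1)) :
    ⁅x, y⁆ ∈ K := by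
  have : closure s ⊔ lcf G (i + 1) ≤ commutatorLeft K hK hy :=
    sup_le ((closure_le _).2 hs) (lcf_succ_le_commutatorLeft hK hy)
  exact (this hx).2

theorem commutatorElement_swap_mem {K : Subgroup G} {x y : G} :
    ⁅x, y⁆ ∈ K ↔ ⁅y, x⁆ ∈ K := by
  rw [← commutatorElement_inv, inv_mem_iff]

/-- The Jacobi identity modulo elements of higher weight. -/
theorem commutatorElement_jacobi_mem {K : Subgroup G} {i j k : ℕ}
    (hK : lcf G (i + j + k + 1) ≤ K) {a b c : G} (ha : a ∈ lcf G i) (hb : b ∈ lcf G j)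
    (hc : c ∈ lcf G k) (h1 : ⁅⁅a, c⁆, b⁆ ∈ K) (h2 : ⁅⁅b, c⁆, a⁆ ∈ K) : ⁅⁅a, b⁆, c⁆ ∈ K := by
  have hK1 : lcf G (k + i + j + 1) ≤ K := (show k + i + j = i + j + k by omega) ▸ hK
  have hK2 : lcf G (j + k + i + 1) ≤ K := (show j + k + i = i + j + k by omega) ▸ hK
  -- Nested `commutatorLeft` encodes `⁅⁅c, a⁻¹⁆, b⁆ ∈ K`; since these are subgroups, entries may be
  -- replaced by their inverses, as the identity `e` requires.
  have hca : c ∈ commutatorLeft (commutatorLeft K hK1 hb)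
      (lcf_succ_le_commutatorLeft hK1 hb) (inv_mem ha) := by
    refine ⟨hc, commutatorElement_swap_mem.2 ?_⟩
    have : a ∈ commutatorLeft (commutatorLeft K hK1 hb) (i := i) (j := k)
        (by rw [add_comm i k]; exact lcf_succ_le_commutatorLeft hK1 hb) hc :=
      ⟨ha, by rw [add_comm]; exact commutatorElement_mem_lcf ha hc, h1⟩
    exact ((mem_commutatorLeft _ _).1 (inv_mem this)).2
  have hbc : b ∈ commutatorLeft (commutatorLeft K hK2 (inv_mem ha))
      (lcf_succ_le_commutatorLeft hK2 (inv_mem ha)) hc := by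
    have hm := commutatorElement_mem_lcf hb hc
    refine ⟨hb, hm, commutatorElement_swap_mem.2 ?_⟩
    have : a ∈ commutatorLeft K (i := i) (j := j + k) (by rwa [← add_assoc]) hm :=
      ⟨ha, commutatorElement_swap_mem.2 h2⟩
    exact ((mem_commutatorLeft _ _).1 (inv_mem this)).2
  have h3 := ((mem_commutatorLeft _ _).1 (inv_mem hca)).2
  have h4 := ((mem_commutatorLeft _ _).1 (inv_mem hbc)).2
  -- The Hall–Witt identity, solved for one of its three factors.
  have e : ⁅c, ⁅a, b⁆⁆ = (a * c) * ⁅⁅c⁻¹, a⁻¹⁆, b⁆ * (a * c)⁻¹ *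
      ((a * b) * ⁅⁅b⁻¹, c⁆, a⁻¹⁆ * (a * b)⁻¹) := by
    simp [commutatorElement_def, mul_assoc]
  rw [commutatorElement_swap_mem, e]
  refine K.mul_mem (conj_mem_of_lcf_succ_le hK1 ?_ h3.2 _) (conj_mem_of_lcf_succ_le hK2 ?_ h4.2 _)
  · exact commutatorElement_mem_lcf h3.1 hb
  · exact commutatorElement_mem_lcf h4.1 (inv_mem ha)

end Subgroup

/-! ### Lexicographic order and Lyndon words -/

namespace List

variable {A : Type*} [LinearOrder A]

/-- Either `u` is a proper prefix of `v`, or the comparison is decided at a differing letter and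
survives any prolongation. -/
theorem lt_append_dichotomy {u v : List A} (h : u < v) :
    (∃ v', v' ≠ [] ∧ v = u ++ v') ∨ ∀ s s', u ++ s < v ++ s' := by
  induction u generalizing v with
  | nil => exact Or.inl ⟨v, by rintro rfl; simp at h, rfl⟩
  | cons a u ih =>
    cases v with
    | nil => simp at h
    | cons b v =>
      rw [cons_lt_cons_iff] at h
      rcases h with h | ⟨rfl, h⟩
      · exact Or.inr fun s s' => by simp [cons_lt_cons_iff, h]
      · rcases ih h with ⟨v', hv', rfl⟩ | h
        · exact Or.inl ⟨v', hv', rfl⟩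
        · exact Or.inr fun s s' => by simpa using h s s'

theorem append_lt_append_of_length_eq {u v : List A} (h : u < v) (hl : u.length = v.length)
    (s s' : List A) : u ++ s < v ++ s' := by
  rcases lt_append_dichotomy h with ⟨v', hv', rfl⟩ | h
  · simp_all
  · exact h s s'

theorem lt_append_of_ne_nil (u : List A) {s : List A} (hs : s ≠ []) : u < u ++ s := by
  obtain ⟨a, s, rfl⟩ := List.exists_cons_of_ne_nil hs
  simpa using List.append_left_lt (l₁ := u) (List.nil_lt_cons a s)

/-- A word is Lyndon if it is smaller than each of its proper nonempty suffixes. -/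
def IsLyndon (w : List A) : Prop :=
  ∀ p s, w = p ++ s → p ≠ [] → s ≠ [] → w < s

theorem IsLyndon.append_lt {u v : List A} (hv : IsLyndon v) (hu : u ≠ []) (h : u < v) :
    u ++ v < v := by
  rcases lt_append_dichotomy h with ⟨v', hv', rfl⟩ | h
  · exact List.append_left_lt (hv u v' rfl hu hv')
  · simpa using h v []

end List

/-! ### Hall trees and their Lyndon words -/

namespace FreeMagma

variable {A : Type*}

/-- The word formed by the leaves of a tree. -/
def word : FreeMagma A → List A
  | of a => [a]
  | mul x y => word x ++ word y

@[simp] theorem word_of (a : A) : word (of a) = [a] := rfl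
@[simp] theorem word_mul (x y : FreeMagma A) : word (x * y) = word x ++ word y := rfl

theorem word_ne_nil (t : FreeMagma A) : word t ≠ [] := by
  induction t with
  | ih1 => simp
  | ih2 x y hx hy => simp [hx]

theorem length_word_pos (t : FreeMagma A) : 0 < (word t).length :=
  List.length_pos_of_ne_nil (word_ne_nil t)

theorem of_ne_mul (a : A) (x y : FreeMagma A) : of a ≠ x * y := fun h => by cases h

theorem mul_inj {x y x' y' : FreeMagma A} : x * y = x' * y' ↔ x = x' ∧ y = y' :=
  ⟨fun h => by cases h; exact ⟨rfl, rfl⟩, by rintro ⟨rfl, rfl⟩; rfl⟩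

/-- The group commutator with the shape of a given tree. -/
def commutator {G : Type*} [Group G] (g : A → G) : FreeMagma A → G
  | of a => g a
  | mul x y => ⁅commutator g x, commutator g y⁆

section
variable {G : Type*} [Group G] (g : A → G)

@[simp] theorem commutator_of (a : A) : commutator g (of a) = g a := rfl
@[simp] theorem commutator_mul (x y : FreeMagma A) :
    commutator g (x * y) = ⁅commutator g x, commutator g y⁆ := rfl

theorem commutator_mem_lcf (t : FreeMagma A) :
    commutator g t ∈ Subgroup.lcf G (word t).length := by
  induction t with
  | ih1 => simp [Subgroup.lcf_one]
  | ih2 x y hx hy =>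
    simpa using Subgroup.commutatorElement_mem_lcf hx hy
end

variable [LinearOrder A]

/-- The Hall trees whose words are the Lyndon words. -/
def IsHall : FreeMagma A → Prop
  | of _ => True
  | mul x y => IsHall x ∧ IsHall y ∧ word x < word y ∧ ∀ x' x'', x = x' * x'' → word y ≤ word x''

theorem isHall_of (a : A) : IsHall (of a) := trivial

theorem isHall_mul {x y : FreeMagma A} : IsHall (x * y) ↔ IsHall x ∧ IsHall y ∧
    word x < word y ∧ ∀ x' x'', x = x' * x'' → word y ≤ word x'' := Iff.rfl

theorem isHall_mul_suffix_ge {x y : FreeMagma A} (hx : ∀ x' x'', x = x' * x'' → ∀ p s,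
      word x = p ++ s → p ≠ [] → s ≠ [] → word x'' ≤ s)
    (h : IsHall (x * y)) (hy : (word y).IsLyndon) (p s : List A) (e : word (x * y) = p ++ s)
    (hp : p ≠ []) (hs : s ≠ []) : word y ≤ s := by
  rw [word_mul, List.append_eq_append_iff] at e
  rcases e with ⟨r, rfl, e⟩ | ⟨r, e, rfl⟩
  · rcases eq_or_ne r [] with rfl | hr
    · simp [e]
    · exact (hy r s e hr hs).le
  · rcases eq_or_ne r [] with rfl | hr
    · simp
    have hr' : word y ≤ r := by
      cases x with
      | of a =>
        obtain ⟨b, p, rfl⟩ := List.exists_cons_of_ne_nil hp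
        change [a] = _ at e
        simp at e
        tauto
      | mul x' x'' => exact ((isHall_mul.1 h).2.2.2 x' x'' rfl).trans (hx x' x'' rfl p r e hp hr)
    exact hr'.trans (List.lt_append_of_ne_nil r (word_ne_nil y)).le

/-- The two claims are proved jointly: minimality of the right factor among proper suffixes uses the
Lyndon property of that factor, and in turn yields it for the whole tree. -/
theorem IsHall.lyndon_and_suffix_ge {t : FreeMagma A} (h : IsHall t) :
    (word t).IsLyndon ∧ ∀ x y, t = x * y → ∀ p s, word t = p ++ s → p ≠ [] → s ≠ [] →
      word y ≤ s := by
  induction t with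
  | ih1 a =>
    refine ⟨fun p s e hp hs => ?_, fun x y e => (of_ne_mul _ _ _ e).elim⟩
    obtain ⟨b, p, rfl⟩ := List.exists_cons_of_ne_nil hp
    simp at e
    tauto
  | ih2 x y ihx ihy =>
    obtain ⟨hx, hy, hlt, -⟩ := isHall_mul.1 h
    have key := isHall_mul_suffix_ge (ihx hx).2 h (ihy hy).1
    refine ⟨fun p s e hp hs => ?_, fun x' y' e => ?_⟩
    · exact ((ihy hy).1.append_lt (word_ne_nil x) hlt).trans_le (key p s e hp hs)
    · obtain ⟨rfl, rfl⟩ := mul_inj.1 e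
      exact key

theorem IsHall.isLyndon {t : FreeMagma A} (h : IsHall t) : (word t).IsLyndon :=
  h.lyndon_and_suffix_ge.1

theorem IsHall.word_mul_lt {x y : FreeMagma A} (h : IsHall (x * y)) :
    word (x * y) < word y :=
  h.isLyndon _ _ rfl (word_ne_nil x) (word_ne_nil y)

/-- The right factor spells the smallest proper nonempty suffix, so the word determines the top
splitting. -/
theorem IsHall.eq_of_word_eq {t t' : FreeMagma A} (h : IsHall t) (h' : IsHall t')
    (e : word t = word t') : t = t' := by
  induction t generalizing t' with
  | ih1 a =>
    induction t' with
    | ih1 b => exact congrArg of (by simpa using e)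
    | ih2 x y =>
      have := congrArg List.length e
      have h1 := length_word_pos x
      have h2 := length_word_pos y
      simp at this
      omega
  | ih2 x y ihx ihy =>
    induction t' with
    | ih1 b =>
      have := congrArg List.length e
      have h1 := length_word_pos x
      have h2 := length_word_pos y
      simp at this
      omega
    | ih2 x' y' =>
      have hy : word y = word y' := le_antisymm
        (h.lyndon_and_suffix_ge.2 x y rfl _ _ e (word_ne_nil _) (word_ne_nil _))
        (h'.lyndon_and_suffix_ge.2 x' y' rfl _ _ e.symm (word_ne_nil _) (word_ne_nil _))
      have hx : word x = word x' := by
        rw [word_mul, word_mul, hy] at e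
        exact List.append_cancel_right e
      rw [ihx (isHall_mul.1 h).1 (isHall_mul.1 h').1 hx,
        ihy (isHall_mul.1 h).2.1 (isHall_mul.1 h').2.1 hy]

/-! ### Hall commutators generate the graded pieces -/

section Span

open Subgroup

variable {G : Type*} [Group G] (g : A → G)

/-- The subgroup generated by the commutators of weight `n` which belong to Hall trees with words
in `W`, and all elements of weight `n + 1`. -/
def hallSpan (n : ℕ) (W : Set (List A)) : Subgroup G :=
  closure (commutator g '' {t | IsHall t ∧ (word t).length = n ∧ word t ∈ W}) ⊔ lcf G (n + 1)

theorem lcf_le_hallSpan (n : ℕ) (W : Set (List A)) : lcf G (n + 1) ≤ hallSpan g n W := le_sup_right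

theorem hallSpan_le_lcf (n : ℕ) (W : Set (List A)) : hallSpan g n W ≤ lcf G n := by
  refine sup_le ((closure_le _).2 ?_) (lcf_antitone (Nat.le_succ n))
  rintro _ ⟨t, ⟨-, rfl, -⟩, rfl⟩
  exact commutator_mem_lcf g t

theorem hallSpan_mono (n : ℕ) {W W' : Set (List A)} (h : W ⊆ W') :
    hallSpan g n W ≤ hallSpan g n W' := by
  refine sup_le_sup_right (Subgroup.closure_mono (Set.image_mono ?_)) _
  exact fun _ ht => ⟨ht.1, ht.2.1, h ht.2.2⟩

theorem commutator_mem_hallSpan {t : FreeMagma A} (h : IsHall t) {n : ℕ}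
    (hn : (word t).length = n) {W : Set (List A)} (hW : word t ∈ W) :
    commutator g t ∈ hallSpan g n W :=
  mem_sup_left (Subgroup.subset_closure ⟨t, ⟨h, hn, hW⟩, rfl⟩)

theorem commutatorElement_mem_of_mem_hallSpan {K : Subgroup G} {i j : ℕ} {W : Set (List A)}
    (hK : lcf G (i + j + 1) ≤ K) {y : G} (hy : y ∈ lcf G j)
    (h : ∀ t, IsHall t → (word t).length = i → word t ∈ W → ⁅commutator g t, y⁆ ∈ K) {x : G}
    (hx : x ∈ hallSpan g i W) : ⁅x, y⁆ ∈ K := by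
  refine commutatorElement_mem_of_mem_closure_sup hK hy ?_ hx
  rintro _ ⟨t, ⟨ht, rfl, hW⟩, rfl⟩
  exact ⟨commutator_mem_lcf g t, h t ht rfl hW⟩

/-- Commutators of Hall commutators are products of Hall commutators, up to higher weight. -/
theorem commutatorElement_hall_mem [Finite A] (n : ℕ) (v : List A) (hv : v.length ≤ n)
    (x y : FreeMagma A) (hx : IsHall x) (hy : IsHall y)
    (hn : (word x).length + (word y).length = n) (hxv : word x ≤ v) (hyv : word y ≤ v) :
    ⁅commutator g x, commutator g y⁆ ∈ hallSpan g n (Set.Iio v) := by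
  induction n using Nat.strong_induction_on generalizing v x y with
  | _ n ihn =>
  revert x y
  -- Inner induction on `v`: the lexicographic order is well-founded on words of length at most `n`,
  -- since there are finitely many.
  refine ((List.finite_length_le A n).wellFoundedOn (r := (· < ·))).induction
    (P := fun v => ∀ x y : FreeMagma A, IsHall x → IsHall y →
      (word x).length + (word y).length = n → word x ≤ v → word y ≤ v →
      ⁅commutator g x, commutator g y⁆ ∈ hallSpan g n (Set.Iio v)) hv ?_
  intro v hv ihv x y hx hy hn hxv hyv
  replace hv : v.length ≤ n := hv
  have below (x y : FreeMagma A) (hx : IsHall x) (hy : IsHall y)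
      (hn : (word x).length + (word y).length = n) (hxv : word x < v) (hyv : word y < v) :
      ⁅commutator g x, commutator g y⁆ ∈ hallSpan g n (Set.Iio v) := by
    rcases le_total (word x) (word y) with h | h
    · exact hallSpan_mono g n (Set.Iio_subset_Iio hyv.le)
        (ihv _ (show _ ≤ n by omega) hyv x y hx hy hn h le_rfl)
    · exact hallSpan_mono g n (Set.Iio_subset_Iio hxv.le)
        (ihv _ (show _ ≤ n by omega) hxv x y hx hy hn le_rfl h)
  have main (x y : FreeMagma A) (hx : IsHall x) (hy : IsHall y)
      (hn : (word x).length + (word y).length = n) (hxy : word x < word y) (hyv : word y ≤ v) :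
      ⁅commutator g x, commutator g y⁆ ∈ hallSpan g n (Set.Iio v) := by
    rcases hyv.lt_or_eq with hyv | rfl
    · exact below x y hx hy hn (hxy.trans hyv) hyv
    have hall (h : ∀ x' x'', x = x' * x'' → word y ≤ word x'') :
        ⁅commutator g x, commutator g y⁆ ∈ hallSpan g n (Set.Iio (word y)) := by
      have ht : IsHall (x * y) := isHall_mul.2 ⟨hx, hy, hxy, h⟩
      exact commutator_mem_hallSpan g ht (by simpa using hn) ht.word_mul_lt
    induction x with
    | ih1 a => exact hall fun _ _ e => (of_ne_mul _ _ _ e).elim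
    | ih2 x' x'' =>
      rcases le_or_gt (word y) (word x'') with h | h
      · exact hall fun _ _ e => by rwa [← (mul_inj.1 e).2]
      obtain ⟨hx', hx'', hlt, -⟩ := isHall_mul.1 hx
      have hlt' : word x' < word y :=
        (List.lt_append_of_ne_nil _ (word_ne_nil x'')).trans hxy
      have p' := length_word_pos x'
      have p'' := length_word_pos x''
      have e : (word x').length + (word x'').length + (word y).length = n := by simpa using hn
      have hK : ∀ m, m = n + 1 → lcf G m ≤ hallSpan g n (Set.Iio (word y)) := by
        rintro _ rfl; exact lcf_le_hallSpan g n _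
      rw [commutator_mul]
      -- The tree `x * y` is not Hall here, so the Jacobi identity is used. By induction on weight,
      -- `⁅x', y⁆` and `⁅x'', y⁆` reduce to Hall commutators with words below `word y`; bracketing
      -- these with `x''` or `x'` then falls under `below`.
      refine commutatorElement_jacobi_mem (hK _ (by omega)) (commutator_mem_lcf g x')
        (commutator_mem_lcf g x'') (commutator_mem_lcf g y) ?_ ?_
      · refine commutatorElement_mem_of_mem_hallSpan g (hK _ ?_) (commutator_mem_lcf g x'')
          (fun t ht hl hW => below t x'' ht hx'' ?_ hW h)
          (ihn _ ?_ (word y) ?_ x' y hx' hy rfl hlt'.le le_rfl) <;> omega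
      · refine commutatorElement_mem_of_mem_hallSpan g (hK _ ?_) (commutator_mem_lcf g x')
          (fun t ht hl hW => below t x' ht hx' ?_ hW hlt')
          (ihn _ ?_ (word y) ?_ x'' y hx'' hy rfl h.le le_rfl) <;> omega
  rcases lt_trichotomy (word x) (word y) with h | h | h
  · exact main x y hx hy hn h hyv
  · rw [hx.eq_of_word_eq hy h, commutatorElement_self]
    exact one_mem _
  · exact commutatorElement_swap_mem.2 (main y x hy hx (by omega) h hxv)

theorem lcf_eq_hallSpan [Finite A] (hg : closure (Set.range g) = ⊤) (n : ℕ) :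
    lcf G (n + 1) = hallSpan g (n + 1) Set.univ := by
  refine le_antisymm ?_ (hallSpan_le_lcf g _ _)
  induction n with
  | zero =>
    rw [zero_add, lcf_one, ← hg, closure_le]
    rintro _ ⟨a, rfl⟩
    exact commutator_mem_hallSpan g (isHall_of a) rfl trivial
  | succ n ih =>
    have hone : (⊤ : Subgroup G) ≤ hallSpan g 1 Set.univ := by
      rw [← hg, closure_le]
      rintro _ ⟨a, rfl⟩
      exact commutator_mem_hallSpan g (isHall_of a) rfl trivial
    rw [lcf_add_two, commutator_le]
    intro x hx y _
    refine commutatorElement_mem_of_mem_hallSpan g (i := n + 1) (j := 1) (lcf_le_hallSpan g _ _)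
      (by rw [lcf_one]; trivial) (fun t ht hl _ => ?_) (ih hx)
    rw [commutatorElement_swap_mem]
    refine commutatorElement_mem_of_mem_hallSpan g (i := 1) (j := n + 1) ?_
      (hl ▸ commutator_mem_lcf g t) (fun t' ht' hl' _ => ?_) (hone (mem_top y))
    · rw [add_comm 1]; exact lcf_le_hallSpan g _ _
    · rcases le_total (word t) (word t') with h | h
      · exact hallSpan_mono g _ (Set.subset_univ _) (commutatorElement_hall_mem g (n + 2) (word t')
          (by omega) t' t ht' ht (by omega) le_rfl h)
      · exact hallSpan_mono g _ (Set.subset_univ _) (commutatorElement_hall_mem g (n + 2) (word t)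
          (by omega) t' t ht' ht (by omega) h le_rfl)

end Span

end FreeMagma

/-! ### Dimension subgroups of a filtered ring -/

/-- A decreasing multiplicative filtration of a ring by additive subgroups. -/
structure RingFiltration (R : Type*) [Ring R] where
  /-- The terms of the filtration. -/
  term : ℕ → AddSubgroup R
  antitone : Antitone term
  one_mem : 1 ∈ term 0
  mul_mem : ∀ {i j : ℕ} {f g : R}, f ∈ term i → g ∈ term j → f * g ∈ term (i + j)

namespace RingFiltration

variable {R G : Type*} [Ring R] [Group G] (J : RingFiltration R) (ρ : G →* Rˣ)

/-- The subgroup of the elements which are congruent to `1` modulo the `n`-th term of the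
filtration. -/
def dimSubgroup (n : ℕ) : Subgroup G where
  carrier := {σ | (ρ σ : R) - 1 ∈ J.term n ∧ (ρ σ⁻¹ : R) - 1 ∈ J.term n}
  one_mem' := by simp [zero_mem]
  inv_mem' := by
    rintro σ ⟨h, h'⟩
    exact ⟨h', by rwa [inv_inv]⟩
  mul_mem' := by
    have key (σ τ : G) (h : (ρ σ : R) - 1 ∈ J.term n) (h' : (ρ τ : R) - 1 ∈ J.term n) :
        (ρ (σ * τ) : R) - 1 ∈ J.term n := by
      have e : (ρ (σ * τ) : R) - 1 =
          ((ρ σ : R) - 1) * ((ρ τ : R) - 1) + ((ρ σ : R) - 1) + ((ρ τ : R) - 1) := by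
        rw [map_mul, Units.val_mul]; noncomm_ring
      rw [e]
      exact add_mem (add_mem (J.antitone (Nat.le_add_right n n) (J.mul_mem h h')) h) h'
    rintro σ τ ⟨h, h'⟩ ⟨k, k'⟩
    exact ⟨key σ τ h k, by rw [mul_inv_rev]; exact key _ _ k' h'⟩

variable {J ρ}

theorem dimSubgroup_antitone : Antitone (J.dimSubgroup ρ) := fun _ _ h _ hσ =>
  ⟨J.antitone h hσ.1, J.antitone h hσ.2⟩

theorem val_mem_term_zero {n : ℕ} {σ : G} (h : σ ∈ J.dimSubgroup ρ n) :
    (ρ σ : R) ∈ J.term 0 := by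
  simpa using add_mem (J.antitone (Nat.zero_le n) h.1) J.one_mem

/-- With `p = ρ σ - 1` and `q = ρ τ - 1`, this comes from `ρ σ * ρ τ - ρ τ * ρ σ = p * q - q * p`.
-/
theorem val_commutatorElement_sub_one (σ τ : G) : (ρ ⁅σ, τ⁆ : R) - 1 =
    (((ρ σ : R) - 1) * ((ρ τ : R) - 1) - ((ρ τ : R) - 1) * ((ρ σ : R) - 1)) *
      ((ρ σ⁻¹ : R) * (ρ τ⁻¹ : R)) := by
  have h : ((ρ τ : R) * (ρ σ : R)) * ((ρ σ⁻¹ : R) * (ρ τ⁻¹ : R)) = 1 := by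
    rw [← Units.val_mul, ← Units.val_mul, ← Units.val_mul, ← map_mul, ← map_mul, ← map_mul]
    simp [mul_assoc]
  have h' : (ρ ⁅σ, τ⁆ : R) = ((ρ σ : R) * (ρ τ : R)) * ((ρ σ⁻¹ : R) * (ρ τ⁻¹ : R)) := by
    simp only [← Units.val_mul, ← map_mul, commutatorElement_def, mul_assoc]
  rw [h', show ((ρ σ : R) - 1) * ((ρ τ : R) - 1) - ((ρ τ : R) - 1) * ((ρ σ : R) - 1)
    = (ρ σ : R) * (ρ τ : R) - (ρ τ : R) * (ρ σ : R) by noncomm_ring, sub_mul, h]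

theorem commutatorElement_mem_dimSubgroup {i j : ℕ} {σ τ : G} (hσ : σ ∈ J.dimSubgroup ρ i)
    (hτ : τ ∈ J.dimSubgroup ρ j) : ⁅σ, τ⁆ ∈ J.dimSubgroup ρ (i + j) := by
  have key {i j : ℕ} {σ τ : G} (hσ : σ ∈ J.dimSubgroup ρ i)
      (hτ : τ ∈ J.dimSubgroup ρ j) : (ρ ⁅σ, τ⁆ : R) - 1 ∈ J.term (i + j) := by
    rw [val_commutatorElement_sub_one]
    refine J.mul_mem (j := 0) (sub_mem (J.mul_mem hσ.1 hτ.1) ?_)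
      (J.mul_mem (i := 0) (j := 0) (val_mem_term_zero (inv_mem hσ))
        (val_mem_term_zero (inv_mem hτ)))
    exact (add_comm j i ▸ J.mul_mem hτ.1 hσ.1 : _ ∈ J.term (i + j))
  refine ⟨key hσ hτ, ?_⟩
  rw [commutatorElement_inv, add_comm]
  exact key hτ hσ

/-- The condition on the inverse is automatic, as `ρ σ⁻¹ - 1 = -(ρ σ - 1) * ρ σ⁻¹` with `ρ σ⁻¹` in
the zeroth term. -/
theorem mem_dimSubgroup_iff (h : J.dimSubgroup ρ 1 = ⊤) {n : ℕ} {σ : G} :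
    σ ∈ J.dimSubgroup ρ n ↔ (ρ σ : R) - 1 ∈ J.term n := by
  refine ⟨fun h => h.1, fun hσ => ⟨hσ, ?_⟩⟩
  have e : (ρ σ⁻¹ : R) - 1 = -(((ρ σ : R) - 1) * (ρ σ⁻¹ : R)) := by
    have : (ρ σ : R) * (ρ σ⁻¹ : R) = 1 := by simp [← Units.val_mul]
    rw [sub_mul, this]; noncomm_ring
  rw [e]
  exact neg_mem (J.mul_mem (j := 0) hσ
    (val_mem_term_zero (J := J) (n := 1) (by rw [h]; trivial)))

/-- Used for both the Magnus algebra and the unitriangular matrices. -/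
theorem lcf_le_dimSubgroup (h : J.dimSubgroup ρ 1 = ⊤) (n : ℕ) :
    Subgroup.lcf G (n + 1) ≤ J.dimSubgroup ρ (n + 1) := by
  induction n with
  | zero => simp [h]
  | succ n ih =>
    rw [Subgroup.lcf_add_two, Subgroup.commutator_le]
    exact fun σ hσ τ _ => commutatorElement_mem_dimSubgroup (ih hσ) (by rw [h]; trivial)

end RingFiltration

/-! ### Order filtration of the Magnus algebra -/

namespace MagnusAlgebra

variable {R A : Type*} [CommRing R]

theorem coeff_sub (I : List A) (f g : MagnusAlgebra R A) :
    coeff I (f - g) = coeff I f - coeff I g := rfl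

theorem coeff_one_of_ne_nil {I : List A} (h : I ≠ []) : coeff I (1 : MagnusAlgebra R A) = 0 := by
  obtain ⟨a, I, rfl⟩ := List.exists_cons_of_ne_nil h
  simp

theorem coeff_sub_one_of_ne_nil {I : List A} (h : I ≠ []) (f : MagnusAlgebra R A) :
    coeff I (f - 1) = coeff I f := by
  rw [coeff_sub, coeff_one_of_ne_nil h, sub_zero]

variable (R A) in
/-- The filtration of the Magnus algebra by the order of a series. -/
def orderFiltration : RingFiltration (MagnusAlgebra R A) where
  term n :=
    { carrier := {f | ∀ I : List A, I.length < n → coeff I f = 0}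
      zero_mem' := fun _ _ => rfl
      add_mem' := fun hf hg I hI => by rw [coeff_add, hf I hI, hg I hI, add_zero]
      neg_mem' := fun hf I hI => by rw [coeff_neg, hf I hI, neg_zero] }
  antitone _ _ h _ hf I hI := hf I (hI.trans_le h)
  one_mem I hI := by simp at hI
  mul_mem {i j f g} hf hg I hI := by
    rw [coeff_mul]
    refine Finset.sum_eq_zero fun k hk => ?_
    have hk := Finset.mem_range.1 hk
    by_cases h : k < i
    · rw [hf _ (by rw [List.length_take]; omega), zero_mul]
    · rw [hg _ (by rw [List.length_drop]; omega), mul_zero]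

theorem mem_term_orderFiltration {n : ℕ} {f : MagnusAlgebra R A} :
    f ∈ (orderFiltration R A).term n ↔ ∀ I : List A, I.length < n → coeff I f = 0 := Iff.rfl

theorem coeff_mul_of_length_eq {i j : ℕ} {f g : MagnusAlgebra R A}
    (hf : f ∈ (orderFiltration R A).term i) (hg : g ∈ (orderFiltration R A).term j) {I : List A}
    (hI : I.length = i + j) : coeff I (f * g) = coeff (I.take i) f * coeff (I.drop i) g := by
  rw [coeff_mul]
  refine Finset.sum_eq_single i (fun k hk hne => ?_) (fun h => ?_)
  · rcases lt_or_gt_of_ne hne with h | h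
    · rw [hf _ (by rw [List.length_take]; omega), zero_mul]
    · rw [hg _ (by rw [List.length_drop]; have := Finset.mem_range.1 hk; omega), mul_zero]
  · simp at h; omega

theorem mem_V_iff {n : ℕ} (hn : 1 ≤ n) {f : MagnusAlgebra R A} :
    f ∈ V R A n ↔ f - 1 ∈ (orderFiltration R A).term n := by
  rw [mem_term_orderFiltration]
  constructor
  · rintro ⟨h0, h⟩ I hI
    rcases eq_or_ne I [] with rfl | hne
    · rw [coeff_sub, h0, coeff_nil_one, sub_self]
    · rw [coeff_sub_one_of_ne_nil hne]
      exact h I (List.length_pos_of_ne_nil hne) hI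
  · intro h
    refine ⟨?_, fun I h1 hI => ?_⟩
    · have := h [] (Nat.lt_of_lt_of_le Nat.zero_lt_one hn)
      rwa [coeff_sub, coeff_nil_one, sub_eq_zero] at this
    · rw [← coeff_sub_one_of_ne_nil (List.ne_nil_of_length_pos h1)]
      exact h I hI

end MagnusAlgebra

theorem FreeGroupBasis.closure_range_eq_top {A S : Type*} [Group S] (b : FreeGroupBasis A S) :
    Subgroup.closure (Set.range b) = ⊤ := by
  have h := congrArg (Subgroup.map b.repr.symm.toMonoidHom) (FreeGroup.closure_range_of A)
  rw [MonoidHom.map_closure, ← Set.range_comp, Subgroup.map_top_of_surjective _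
    b.repr.symm.surjective] at h
  exact h

/-! ### Magnus dimension subgroups and leading coefficients -/

section Magnus

open MagnusAlgebra

variable {R A S : Type*} [CommRing R] [Group S] (b : FreeGroupBasis A S)

theorem magnusHom_apply (a : A) : (magnusHom R b (b a) : MagnusAlgebra R A) = 1 + X a := by
  simp [magnusHom, oneAddX]

theorem magnusHom_apply_inv (a : A) :
    (magnusHom R b (b a)⁻¹ : MagnusAlgebra R A) = invOneAddX a := by
  rw [map_inv]
  simp [magnusHom, oneAddX]

variable (R) in
/-- The Magnus dimension subgroups of a free group. -/
abbrev magnusSubgroup (n : ℕ) : Subgroup S := (orderFiltration R A).dimSubgroup (magnusHom R b) n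

theorem magnusSubgroup_one : magnusSubgroup R b 1 = ⊤ := by
  rw [eq_top_iff, ← b.closure_range_eq_top, Subgroup.closure_le]
  have key (f : MagnusAlgebra R A) (hf : coeff [] f = 1) : f - 1 ∈ (orderFiltration R A).term 1 := by
    intro I hI
    obtain rfl : I = [] := List.length_eq_zero_iff.1 (by omega)
    rw [coeff_sub, hf, coeff_nil_one, sub_self]
  rintro _ ⟨a, rfl⟩
  refine ⟨key _ ?_, key _ ?_⟩
  · simp [magnusHom_apply]
  · rw [magnusHom_apply_inv, coeff_nil_invOneAddX]

theorem mem_magnusSubgroup_iff {n : ℕ} (hn : 1 ≤ n) {σ : S} :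
    σ ∈ magnusSubgroup R b n ↔ (magnusHom R b σ : MagnusAlgebra R A) ∈ V R A n := by
  rw [mem_V_iff hn, RingFiltration.mem_dimSubgroup_iff (magnusSubgroup_one b)]

theorem lcf_le_magnusSubgroup (n : ℕ) : Subgroup.lcf S (n + 1) ≤ magnusSubgroup R b (n + 1) :=
  RingFiltration.lcf_le_dimSubgroup (magnusSubgroup_one b) n

/-- The cross term `(Λ σ - 1) * (Λ τ - 1)` has order at least `2n > n`. -/
theorem coeff_magnusHom_mul {n : ℕ} {σ τ : S} (hσ : σ ∈ magnusSubgroup R b n)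
    (hτ : τ ∈ magnusSubgroup R b n) {I : List A} (h0 : I ≠ []) (hI : I.length = n) :
    coeff I (magnusHom R b (σ * τ) : MagnusAlgebra R A) =
      coeff I (magnusHom R b σ : MagnusAlgebra R A) +
      coeff I (magnusHom R b τ : MagnusAlgebra R A) := by
  have hpos := List.length_pos_of_ne_nil h0
  have e : (magnusHom R b (σ * τ) : MagnusAlgebra R A) =
      ((magnusHom R b σ : MagnusAlgebra R A) - 1) * ((magnusHom R b τ : MagnusAlgebra R A) - 1) +
      (magnusHom R b σ : MagnusAlgebra R A) + ((magnusHom R b τ : MagnusAlgebra R A) - 1) := by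
    rw [map_mul, Units.val_mul]; noncomm_ring
  rw [e, coeff_add, coeff_add, coeff_sub_one_of_ne_nil h0,
    (orderFiltration R A).mul_mem hσ.1 hτ.1 I (by omega), zero_add]

/-- The coefficient at a nonempty word `I`, as a homomorphism on the Magnus dimension subgroup of
index `|I|`. -/
def leadingCoeff {I : List A} (h0 : I ≠ []) :
    magnusSubgroup R b I.length →* Multiplicative R where
  toFun σ := Multiplicative.ofAdd (coeff I (magnusHom R b σ : MagnusAlgebra R A))
  map_one' := by simp [coeff_one_of_ne_nil h0]
  map_mul' σ τ := by
    rw [← ofAdd_add, ← coeff_magnusHom_mul b σ.2 τ.2 h0 rfl]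
    rfl

/-- In lowest degree a group commutator becomes the Lie bracket of leading parts; the remaining
factor has constant term `1`. -/
theorem coeff_magnusHom_commutatorElement {i j : ℕ} (hi : 1 ≤ i) (hj : 1 ≤ j) {σ τ : S}
    (hσ : σ ∈ magnusSubgroup R b i) (hτ : τ ∈ magnusSubgroup R b j) {I : List A}
    (hI : I.length = i + j) :
    coeff I (magnusHom R b ⁅σ, τ⁆ : MagnusAlgebra R A) =
      coeff (I.take i) (magnusHom R b σ : MagnusAlgebra R A) *
        coeff (I.drop i) (magnusHom R b τ : MagnusAlgebra R A) -
      coeff (I.take j) (magnusHom R b τ : MagnusAlgebra R A) *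
        coeff (I.drop j) (magnusHom R b σ : MagnusAlgebra R A) := by
  have h0 : I ≠ [] := List.ne_nil_of_length_pos (by omega)
  have hnil (ν : S) : coeff [] (magnusHom R b ν : MagnusAlgebra R A) = 1 :=
    ((mem_magnusSubgroup_iff b le_rfl).1 (by rw [magnusSubgroup_one]; trivial)).1
  have hpq := (orderFiltration R A).mul_mem hσ.1 hτ.1
  have hqp := (orderFiltration R A).mul_mem hτ.1 hσ.1
  have ht : ∀ k, 1 ≤ k → k < i + j → I.take k ≠ [] ∧ I.drop k ≠ [] := fun k h1 h2 =>
    ⟨List.ne_nil_of_length_pos (by rw [List.length_take]; omega),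
      List.ne_nil_of_length_pos (by rw [List.length_drop]; omega)⟩
  rw [← coeff_sub_one_of_ne_nil h0, RingFiltration.val_commutatorElement_sub_one,
    coeff_mul_of_length_eq (i := i + j) (j := 0)
      (sub_mem hpq (by rw [add_comm]; exact hqp)) (fun _ h => by simp at h) hI,
    ← hI, List.take_length, List.drop_length, coeff_nil_mul, hnil, hnil, mul_one, mul_one, coeff_sub,
    coeff_mul_of_length_eq hσ.1 hτ.1 hI, coeff_mul_of_length_eq hτ.1 hσ.1 (by omega),
    coeff_sub_one_of_ne_nil (ht i hi (by omega)).1, coeff_sub_one_of_ne_nil (ht i hi (by omega)).2,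
    coeff_sub_one_of_ne_nil (ht j hj (by omega)).1, coeff_sub_one_of_ne_nil (ht j hj (by omega)).2]

/-! ### Triangularity of Hall commutators -/

open FreeMagma

theorem commutator_mem_magnusSubgroup (t : FreeMagma A) :
    commutator b t ∈ magnusSubgroup R b (word t).length := by
  have h := commutator_mem_lcf b t
  obtain ⟨n, hn⟩ := Nat.exists_eq_add_of_le' (length_word_pos t)
  rw [hn] at h ⊢
  exact lcf_le_magnusSubgroup b n h

variable [LinearOrder A]

theorem coeff_magnusHom_commutator_hall {t : FreeMagma A} (ht : IsHall t) :
    coeff (word t) (magnusHom R b (commutator b t) : MagnusAlgebra R A) = 1 ∧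
      ∀ I : List A, I.length = (word t).length → I < word t →
        coeff I (magnusHom R b (commutator b t) : MagnusAlgebra R A) = 0 := by
  induction t with
  | ih1 a =>
    rw [commutator_of, magnusHom_apply]
    constructor
    · rw [word_of, coeff_add, coeff_cons_one, zero_add]
      exact if_pos rfl
    · intro I hI hlt
      have h0 : I ≠ [] := List.ne_nil_of_length_pos (by simp [hI])
      rw [coeff_add, coeff_one_of_ne_nil h0, zero_add]
      exact if_neg hlt.ne
  | ih2 x y ihx ihy =>
    obtain ⟨hx, hy, hlt, -⟩ := isHall_mul.1 ht
    obtain ⟨ihx, ihx'⟩ := ihx hx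
    obtain ⟨ihy, ihy'⟩ := ihy hy
    have px := length_word_pos x
    have py := length_word_pos y
    -- The subtracted bracket term vanishes: the prefix of `I` of length `|word y|` is below `I ≤
    -- word (x * y) < word y`.
    have second (I : List A) (hI : I.length = (word x).length + (word y).length)
        (hle : I ≤ word (x * y)) :
        coeff (I.take (word y).length)
          (magnusHom R b (commutator b y) : MagnusAlgebra R A) = 0 := by
      refine ihy' _ (by rw [List.length_take]; omega) (lt_of_not_ge fun h => ?_)
      have : I.take (word y).length < I := by
        conv_rhs => rw [← List.take_append_drop (word y).length I]
        exact List.lt_append_of_ne_nil _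
          (List.ne_nil_of_length_pos (by rw [List.length_drop]; omega))
      exact absurd (h.trans_lt (this.trans_le hle)) (not_lt_of_gt ht.word_mul_lt)
    have expand (I : List A) (hI : I.length = (word x).length + (word y).length)
        (hle : I ≤ word (x * y)) :
        coeff I (magnusHom R b (commutator b (x * y)) : MagnusAlgebra R A) =
          coeff (I.take (word x).length)
            (magnusHom R b (commutator b x) : MagnusAlgebra R A) *
          coeff (I.drop (word x).length)
            (magnusHom R b (commutator b y) : MagnusAlgebra R A) := by
      rw [commutator_mul, coeff_magnusHom_commutatorElement b px py
        (commutator_mem_magnusSubgroup b x) (commutator_mem_magnusSubgroup b y) hI,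
        second I hI hle, zero_mul, sub_zero]
    constructor
    · rw [expand _ (by simp) le_rfl]
      simp [ihx, ihy]
    · intro I hI hI'
      have hl : I.length = (word x).length + (word y).length := by simpa using hI
      rw [expand I hl hI'.le]
      have hl1 : (I.take (word x).length).length = (word x).length := by
        rw [List.length_take]; omega
      rcases lt_trichotomy (I.take (word x).length) (word x) with h | h | h
      · rw [ihx' _ hl1 h, zero_mul]
      · rw [ihy' _ (by rw [List.length_drop]; omega), mul_zero]
        refine lt_of_not_ge fun hge => not_le_of_gt hI' ?_
        rw [← List.take_append_drop (word x).length I, h, word_mul]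
        rcases hge.lt_or_eq with hge | hge
        · exact (List.append_left_lt hge).le
        · rw [hge]
      · refine absurd hI' (not_lt_of_gt ?_)
        rw [← List.take_append_drop (word x).length I, word_mul]
        exact List.append_lt_append_of_length_eq h hl1.symm _ _

theorem coeff_magnusHom_hallSpan {w : List A} (h0 : w ≠ []) {W : Set (List A)}
    (hW : ∀ u ∈ W, w < u) {σ : S} (hσ : σ ∈ hallSpan b w.length W) :
    coeff w (magnusHom R b σ : MagnusAlgebra R A) = 0 := by
  have hpos := List.length_pos_of_ne_nil h0
  have key : hallSpan b w.length W ≤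
      (leadingCoeff (R := R) b h0).ker.map (magnusSubgroup R b w.length).subtype := by
    refine sup_le ((Subgroup.closure_le _).2 ?_) fun τ hτ => ?_
    · rintro _ ⟨t, ⟨ht, hl, htW⟩, rfl⟩
      refine ⟨⟨commutator b t, hl ▸ commutator_mem_magnusSubgroup b t⟩, ?_, rfl⟩
      exact congrArg Multiplicative.ofAdd
        ((coeff_magnusHom_commutator_hall b ht).2 w hl.symm (hW _ htW))
    · have hτ' := lcf_le_magnusSubgroup (R := R) b _ hτ
      refine ⟨⟨τ, RingFiltration.dimSubgroup_antitone (Nat.le_succ _) hτ'⟩, ?_, rfl⟩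
      refine congrArg Multiplicative.ofAdd ?_
      rw [← coeff_sub_one_of_ne_nil h0]
      exact hτ'.1 w (Nat.lt_succ_self _)
  obtain ⟨τ, hτ, rfl⟩ := key hσ
  exact Multiplicative.ofAdd.injective hτ

theorem hallSpan_insert_le {G : Type*} [Group G] (g : A → G) {t : FreeMagma A} (ht : IsHall t)
    (W : Set (List A)) : hallSpan g (word t).length (insert (word t) W) ≤
      Subgroup.zpowers (commutator g t) ⊔ hallSpan g (word t).length W := by
  refine sup_le ((Subgroup.closure_le _).2 ?_) ((lcf_le_hallSpan g _ _).trans le_sup_right)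
  rintro _ ⟨t', ⟨ht', hl, h | hW⟩, rfl⟩
  · rw [ht'.eq_of_word_eq ht h]
    exact Subgroup.mem_sup_left (Subgroup.mem_zpowers _)
  · exact Subgroup.mem_sup_right (commutator_mem_hallSpan g ht' hl hW)

variable [CharZero R]

/-- The smallest word is peeled off first: the coefficient of `σ` there is exactly the exponent of
its Hall commutator, hence zero in `R`, and characteristic zero makes the integer exponent zero. -/
theorem mem_lcf_of_mem_hallSpan (n : ℕ) (W : Finset (List A)) {σ : S}
    (hσ : σ ∈ hallSpan b n W) (h : σ ∈ magnusSubgroup R b (n + 1)) :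
    σ ∈ Subgroup.lcf S (n + 1) := by
  induction W using Finset.induction_on_min with
  | empty => simpa [hallSpan] using hσ
  | insert w W hw ih =>
    rw [Finset.coe_insert] at hσ
    by_cases hex : ∃ t, IsHall t ∧ (word t).length = n ∧ word t = w
    · obtain ⟨t, ht, rfl, rfl⟩ := hex
      -- Normality allows the decomposition `σ = c ^ k * τ`.
      have hnormal : (hallSpan b (word t).length (W : Set (List A))).Normal :=
        Subgroup.normal_of_lcf_le (lcf_le_hallSpan b _ _) (hallSpan_le_lcf b _ _)
      obtain ⟨_, ⟨k, rfl⟩, τ, hτ, rfl⟩ :=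
        Subgroup.mem_sup_of_normal_right.1 (hallSpan_insert_le b ht _ hσ)
      have hk : k = 0 := by
        have h0 := word_ne_nil t
        let c : magnusSubgroup R b (word t).length :=
          ⟨commutator b t, commutator_mem_magnusSubgroup b t⟩
        have hσ' := RingFiltration.dimSubgroup_antitone (Nat.le_succ _) h
        have hτ' : τ ∈ magnusSubgroup R b (word t).length :=
          (Subgroup.mul_mem_cancel_left _ (zpow_mem c.2 k)).1 hσ'
        have e : leadingCoeff b h0 (c ^ k * ⟨τ, hτ'⟩) = 1 := by
          refine congrArg Multiplicative.ofAdd ?_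
          rw [← coeff_sub_one_of_ne_nil h0]
          exact h.1 _ (Nat.lt_succ_self _)
        have e1 : leadingCoeff b h0 ⟨τ, hτ'⟩ = 1 :=
          congrArg Multiplicative.ofAdd (coeff_magnusHom_hallSpan b h0 hw hτ)
        have e2 : leadingCoeff b h0 c = Multiplicative.ofAdd (1 : R) :=
          congrArg Multiplicative.ofAdd (coeff_magnusHom_commutator_hall b ht).1
        rw [map_mul, map_zpow, e1, mul_one, e2, ← ofAdd_zsmul, ofAdd_eq_one] at e
        simpa using e
      subst hk
      simp only [zpow_zero, one_mul] at ih ⊢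
      exact ih hτ
    · refine ih ?_
      refine (?_ : hallSpan b n _ ≤ _) hσ
      refine sup_le_sup_right (Subgroup.closure_mono (Set.image_mono ?_)) _
      rintro t ⟨ht, hl, rfl | hW⟩
      · exact (hex ⟨t, ht, hl, rfl⟩).elim
      · exact ⟨ht, hl, hW⟩

theorem magnusSubgroup_le_lcf [Finite A] (n : ℕ) :
    magnusSubgroup R b (n + 1) ≤ Subgroup.lcf S (n + 1) := by
  induction n with
  | zero => simp [Subgroup.lcf_one]
  | succ n ih =>
    intro σ hσ
    have h := ih (RingFiltration.dimSubgroup_antitone (Nat.le_succ _) hσ)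
    rw [lcf_eq_hallSpan b b.closure_range_eq_top] at h
    refine mem_lcf_of_mem_hallSpan b (n + 1) (List.finite_length_eq A (n + 1)).toFinset ?_ hσ
    refine (?_ : hallSpan b (n + 1) _ ≤ _) h
    refine sup_le_sup_right (Subgroup.closure_mono (Set.image_mono ?_)) _
    rintro t ⟨ht, hl, -⟩
    exact ⟨ht, hl, by simpa using hl⟩

end Magnus

/-! ### Unitriangular matrices kill high weight -/

namespace Matrix

variable {n : ℕ} {R : Type*} [CommRing R]

variable (n R) in
/-- The filtration of the upper-triangular matrices by the distance of the nonzero entries from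
the diagonal. -/
def diagonalFiltration : RingFiltration (Matrix (Fin n) (Fin n) R) where
  term k :=
    { carrier := {M | ∀ i j : Fin n, (j : ℕ) < i + k → M i j = 0}
      zero_mem' := fun _ _ _ => rfl
      add_mem' := fun hM hN i j h => by rw [add_apply, hM i j h, hN i j h, add_zero]
      neg_mem' := fun hM i j h => by rw [neg_apply, hM i j h, neg_zero] }
  antitone _ _ h _ hM i j hij := hM i j (by omega)
  one_mem i j h := one_apply_ne (by rintro rfl; simp at h)
  mul_mem {k l M N} hM hN i j h := by
    rw [mul_apply]
    refine Finset.sum_eq_zero fun m _ => ?_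
    by_cases hm : (m : ℕ) < i + k
    · rw [hM i m hm, zero_mul]
    · rw [hN m j (by omega), mul_zero]

theorem sub_one_mem_diagonalFiltration {g : GL (Fin n) R} (hg : g ∈ unitriangularGroup n R) :
    (g : Matrix (Fin n) (Fin n) R) - 1 ∈ (diagonalFiltration n R).term 1 := by
  intro i j hij
  rw [sub_apply]
  rcases (show j ≤ i from Nat.lt_succ_iff.1 hij).lt_or_eq with h | rfl
  · rw [hg.1 i j h, one_apply_ne h.ne', sub_zero]
  · rw [hg.2 j, one_apply_eq, sub_self]

end Matrix

theorem lcf_le_kerInt_unitriangularGroup (G R : Type*) [Group G] [CommRing R] (n : ℕ) :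
    Subgroup.lcf G (n + 1) ≤ kerInt G (unitriangularGroup (n + 1) R) := by
  refine le_iInf fun φ σ hσ => ?_
  let ρ : G →* GL (Fin (n + 1)) R := (unitriangularGroup (n + 1) R).subtype.comp φ
  have h1 : (Matrix.diagonalFiltration (n + 1) R).dimSubgroup ρ 1 = ⊤ :=
    eq_top_iff.2 fun τ _ => ⟨Matrix.sub_one_mem_diagonalFiltration (φ τ).2,
      Matrix.sub_one_mem_diagonalFiltration (φ τ⁻¹).2⟩
  have h := (RingFiltration.lcf_le_dimSubgroup h1 n hσ).1
  rw [MonoidHom.mem_ker]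
  refine Subtype.ext (Units.ext ?_)
  -- Term `n + 1` of the filtration is zero in size `n + 1`, since every column index is below `n +
  -- 1`.
  refine sub_eq_zero.1 (Matrix.ext fun i j => h i j ?_)
  omega

/-! ### Unipotent representations from Magnus coefficients -/

namespace MagnusAlgebra

variable {R A : Type*} [CommRing R]

/-- The subword of length `k` starting at position `i` of an infinite word. -/
def subword (s : ℕ → A) (i k : ℕ) : List A := (List.range' i k).map s

theorem length_subword (s : ℕ → A) (i k : ℕ) : (subword s i k).length = k := by
  simp [subword]

theorem take_subword (s : ℕ → A) (i : ℕ) {k l : ℕ} (h : l ≤ k) :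
    (subword s i k).take l = subword s i l := by
  refine List.ext_getElem ?_ fun m h1 h2 => ?_
  · simp [subword, h]
  · simp [subword]

theorem drop_subword (s : ℕ → A) (i k l : ℕ) :
    (subword s i k).drop l = subword s (i + l) (k - l) := by
  rw [subword, ← List.map_drop, List.drop_range', mul_one, subword]

/-- The matrix of the coefficients of a series at the subwords of an infinite word. -/
def subwordMatrix (R : Type*) [CommRing R] (n : ℕ) (s : ℕ → A) :
    MagnusAlgebra R A →* Matrix (Fin n) (Fin n) R where
  toFun f := Matrix.of fun i j =>
    if (i : ℕ) ≤ j then coeff (subword s i (j - i)) f else 0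
  map_one' := by
    ext i j
    rw [Matrix.of_apply]
    rcases lt_trichotomy i j with h | rfl | h
    · rw [if_pos (show (i : ℕ) ≤ j from h.le), Matrix.one_apply_ne h.ne, coeff_one_of_ne_nil]
      refine List.ne_nil_of_length_pos ?_
      rw [length_subword]
      have : (i : ℕ) < j := h
      omega
    · simp [subword]
    · rw [if_neg (show ¬ (i : ℕ) ≤ j from not_le_of_gt h), Matrix.one_apply_ne h.ne']
  map_mul' f g := by
    ext i j
    -- The entrywise sum is extended to natural indices; its terms vanish outside `[i, j]`, leaving
    -- the cuts of the subword from `i` to `j`.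
    let F : ℕ → R := fun k => (if (i : ℕ) ≤ k then coeff (subword s i (k - i)) f else 0) *
      (if k ≤ (j : ℕ) then coeff (subword s k (j - k)) g else 0)
    rw [Matrix.mul_apply, Matrix.of_apply]
    change _ = ∑ k : Fin n, F k
    rw [Fin.sum_univ_eq_sum_range F]
    have hsub : Finset.Ico (i : ℕ) (j + 1) ⊆ Finset.range n := fun k hk => by
      simp only [Finset.mem_Ico, Finset.mem_range] at *
      omega
    rw [← Finset.sum_subset hsub]
    · split_ifs with h
      · rw [Finset.sum_Ico_eq_sum_range, coeff_mul, length_subword,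
          show (j : ℕ) + 1 - i = j - i + 1 by omega]
        refine Finset.sum_congr rfl fun k hk => ?_
        have hk' : k ≤ j - i := Nat.lt_succ_iff.1 (Finset.mem_range.1 hk)
        rw [take_subword s i hk', drop_subword]
        simp only [F]
        rw [if_pos (by omega), if_pos (by omega), Nat.add_sub_cancel_left, Nat.sub_sub]
      · rw [Finset.Ico_eq_empty (by omega), Finset.sum_empty]
    · intro k _ hk
      simp only [Finset.mem_Ico, not_and_or, not_le, not_lt] at hk
      rcases hk with hk | hk
      · simp only [F]
        rw [if_neg (by omega), zero_mul]
      · simp only [F]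
        rw [if_neg (c := k ≤ (j : ℕ)) (by omega), mul_zero]

theorem subwordMatrix_apply {n : ℕ} (s : ℕ → A) (f : MagnusAlgebra R A) (i j : Fin n) :
    subwordMatrix R n s f i j = if (i : ℕ) ≤ j then coeff (subword s i (j - i)) f else 0 := rfl

end MagnusAlgebra

section

open MagnusAlgebra

variable {A S : Type*} (R : Type*) [CommRing R] [Group S] (b : FreeGroupBasis A S)

/-- The unipotent representation of a free group given by the Magnus coefficients at the subwords
of an infinite word. -/
def subwordRepresentation (n : ℕ) (s : ℕ → A) : S →* unitriangularGroup n R :=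
  ((Units.map (subwordMatrix R n s)).comp (magnusHom R b)).codRestrict _ fun σ => by
    refine ⟨fun i j h => if_neg (not_le_of_gt h), fun i => ?_⟩
    change subwordMatrix R n s _ i i = 1
    rw [subwordMatrix_apply, if_pos le_rfl, Nat.sub_self]
    exact ((mem_magnusSubgroup_iff b le_rfl).1 (by rw [magnusSubgroup_one]; trivial)).1

theorem kerInt_unitriangularGroup_le_magnusSubgroup (n : ℕ) :
    kerInt S (unitriangularGroup (n + 1) R) ≤ magnusSubgroup R b (n + 1) := by
  intro σ hσ
  rw [RingFiltration.mem_dimSubgroup_iff (magnusSubgroup_one b)]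
  intro I hI
  rcases eq_or_ne I [] with rfl | h0
  · exact (magnusSubgroup_one (R := R) b ▸ Subgroup.mem_top σ : σ ∈ magnusSubgroup R b 1).1 []
      Nat.zero_lt_one
  rw [coeff_sub_one_of_ne_nil h0]
  -- Past the end of `I` the letters are arbitrary: only the entry `(0, |I|)` is read.
  let s : ℕ → A := fun k => I.getD k (I.head h0)
  have hseg : subword s 0 I.length = I := by
    refine List.ext_getElem (length_subword _ _ _) fun k h1 h2 => ?_
    simp [subword, s, h2]
  have hker : subwordRepresentation R b (n + 1) s σ = 1 :=
    (Subgroup.mem_iInf.1 hσ (subwordRepresentation R b (n + 1) s) :)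
  have h := congrArg (fun g : unitriangularGroup (n + 1) R =>
    (g : GL (Fin (n + 1)) R) ⟨0, Nat.succ_pos n⟩ ⟨I.length, hI⟩) hker
  have hpos := List.length_pos_of_ne_nil h0
  change subwordMatrix R (n + 1) s _ _ _ = (1 : Matrix (Fin (n + 1)) (Fin (n + 1)) R) _ _ at h
  rw [subwordMatrix_apply, if_pos (Nat.zero_le _), Matrix.one_apply_ne] at h
  · simpa [hseg] using h
  · simp only [ne_eq, Fin.mk.injEq]
    omega

end

end

theorem mainTheorem3 {A S : Type*} [Finite A] [Group S] (b : FreeGroupBasis A S)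
    (n : ℕ) (hn : 1 ≤ n) :
    (⊤ : Subgroup S).lowerCentralSeries (n - 1) = kerInt S (unitriangularGroup n ℤ) ∧
    ((⊤ : Subgroup S).lowerCentralSeries (n - 1) : Set S) =
      {σ : S | (magnusHom ℤ b σ : MagnusAlgebra ℤ A) ∈ MagnusAlgebra.V ℤ A n} := by
  classical
  obtain ⟨m, rfl⟩ := Nat.exists_eq_add_of_le' hn
  -- Any linear order serves; it only selects the Hall trees.
  let _ : LinearOrder A := IsWellOrder.linearOrder WellOrderingRel
  have h1 := lcf_le_kerInt_unitriangularGroup S ℤ m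
  have h2 := kerInt_unitriangularGroup_le_magnusSubgroup ℤ b m
  have h3 := magnusSubgroup_le_lcf (R := ℤ) b m
  refine ⟨le_antisymm h1 (h2.trans h3), ?_⟩
  ext σ
  rw [Set.mem_ofPred_eq, ← mem_magnusSubgroup_iff b hn]
  exact ⟨fun h => h2 (h1 h), fun h => h3 h⟩
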